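/- Let $0<\lambda_1<\lambda_n$ and $\delta_1,\delta_n>0$. Let $\Psi(w)=\frac{\lambda_1+\lambda_n}{2}+\frac{\lambda_n-\lambda_1}{4}\left(w+\frac1w\right)$ be the Riemann map of $\{w\in\mathbb C:|w|>1\}$ onto $\mathbb C\setminus[\lambda_1,\lambda_n]$ that fixes $\infty$ and has positive derivative there, let $\Phi=\Psi^{-1}$, and put $$B(w)=w\,\frac{1-\overline{\Phi(0)}\,w}{\Phi(0)-w},\qquad E(\sigma)=B\bigl(\Phi(-\sigma)^{-1}\bigr)\in\mathbb R,\qquad \mu=\mu(\sigma)=\sqrt{|E(\sigma)|}\qquad(\sigma\in\mathbb R\setminus[-\lambda_n,-\lambda_1]).$$ For an invertible $A\in\mathbb R^{n\times n}$ and $b\in\mathbb R^n$ let $\mathcal K_j(A,b)$ be the span of the first $j$ vectors of the sequence $b,\ A^{-1}b,\ Ab,\ A^{-2}b,\ A^2b,\dots$, and let $\|\cdot\|$ be the Euclidean norm. There is a constant $C>0$, depending only on $\lambda_1,\lambda_n,\delta_1,\delta_n$, such that for every $\sigma\in\mathbb R\setminus(-\lambda_n-\delta_n,\,-\lambda_1+\delta_1)$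 the following hold. 1. $\mu<1$. 2. For every $n$, every symmetric positive definite $A\in\mathbb R^{n\times n}$ with spectrum in $[\lambda_1,\lambda_n]$, every $b\in\mathbb R^n$ and every integer $j\ge 0$, there is $x_j\in\mathcal K_j(A,b)$ such that $x(\sigma)=(A+\sigma I)^{-1}b$ satisfies $$\|x(\sigma)-x_j\|\le C\,\|b\|\,\mu^{2\lfloor j/2\rfloor}\qquad(\text{with } 0^0=1),$$ and, if $\sigma\ne 0$ (in which case $\mu>0$), also $$\|x(\sigma)-x_j\|\le c\,\mu^{j}\qquad\text{with } c=C\,\|b\|/\mu .$$ 3. If $\sigma\ge 0$, then $\mu\le\dfrac{\kappa^{1/4}-1}{\kappa^{1/4}+1}$, where $\kappa=\lambda_n/\lambda_1$. -/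

import Mathlib

namespace EKS

/-! ### The exterior conformal map of an interval and the associated rate -/

/-- The real interval `[a, b]`, seen as a subset of the complex plane. -/
def segmentC (a b : ℝ) : Set ℂ := (fun t : ℝ => (t : ℂ)) '' Set.Icc a b

/-- The Riemann map `Ψ` from the exterior `{1 < |w|}` of the closed unit disk onto the complement of
`[a, b]` that preserves infinity and has positive derivative there:
`Ψ(w) = c + (r/2) (w + 1/w)` with `c = (a + b)/2` and `r = (b - a)/2`. -/
noncomputable def Psi (a b : ℝ) (w : ℂ) : ℂ :=
  (((a + b) / 2 : ℝ) : ℂ) + ((((b - a) / 2 : ℝ) : ℂ) / 2) * (w + 1 / w)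

/-- The exterior conformal map `Φ = Ψ⁻¹` of `[a, b]`: for `z` outside `[a, b]`, the unique `w` with
`1 < |w|` and `Ψ(w) = z` (see `psi_bijOn`). -/
noncomputable def Phi (a b : ℝ) : ℂ → ℂ :=
  Function.invFunOn (Psi a b) {w : ℂ | 1 < ‖w‖}

/-- The finite Blaschke product `B(w) = w (1 - conj(Φ(0)) w) / (Φ(0) - w)`. -/
noncomputable def B (a b : ℝ) (w : ℂ) : ℂ :=
  w * ((1 - (starRingEnd ℂ) (Phi a b 0) * w) / (Phi a b 0 - w))

/-- The function `E(σ) = B(Φ(-σ)⁻¹)`. The value of `B` there is real (see `ofReal_E`), so that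
taking the real part only adjusts the type. -/
noncomputable def E (a b : ℝ) (σ : ℝ) : ℝ := (B a b (Phi a b (-(σ : ℂ)))⁻¹).re

/-- The rate `μ = √|E(σ)|`. -/
noncomputable def rate (a b : ℝ) (σ : ℝ) : ℝ := Real.sqrt |E a b σ|

/-! ### Extended Krylov subspaces -/

/-- The sequence `b, A⁻¹b, Ab, A⁻²b, A²b, …` (indexed from `0`). -/
noncomputable def krylovVec {n : ℕ} (A : Matrix (Fin n) (Fin n) ℝ) (b : EuclideanSpace ℝ (Fin n))
    (i : ℕ) : EuclideanSpace ℝ (Fin n) :=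
  if Even i then Matrix.toEuclideanLin (A ^ (i / 2)) b
  else Matrix.toEuclideanLin (A⁻¹ ^ ((i + 1) / 2)) b

/-- The extended Krylov subspace `K_j(A, b)`, spanned by the first `j` vectors of
`b, A⁻¹b, Ab, A⁻²b, A²b, …`. -/
noncomputable def extKrylov {n : ℕ} (A : Matrix (Fin n) (Fin n) ℝ) (b : EuclideanSpace ℝ (Fin n))
    (j : ℕ) : Submodule ℝ (EuclideanSpace ℝ (Fin n)) :=
  Submodule.span ℝ (krylovVec A b '' Set.Iio j)

/-- The solution `x(σ) = (A + σ I)⁻¹ b` of the shifted linear system. -/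
noncomputable def shiftedSol {n : ℕ} (A : Matrix (Fin n) (Fin n) ℝ)
    (b : EuclideanSpace ℝ (Fin n)) (σ : ℝ) : EuclideanSpace ℝ (Fin n) :=
  Matrix.toEuclideanLin (A + σ • (1 : Matrix (Fin n) (Fin n) ℝ))⁻¹ b

/-! ### Basic facts: `Ψ` is a bijection, `Φ` is its inverse, and `E` is real -/

theorem psi_injOn {a b : ℝ} (hab : a < b) : Set.InjOn (Psi a b) {w : ℂ | 1 < ‖w‖} := by
  intro w hw v hv h
  simp only [Set.mem_ofPred_eq] at hw hv
  have hw0 : w ≠ 0 := by rintro rfl; simp at hw; linarith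
  have hv0 : v ≠ 0 := by rintro rfl; simp at hv; linarith
  have hr : ((((b - a) / 2 : ℝ) : ℂ) / 2) ≠ 0 := by
    apply div_ne_zero _ two_ne_zero
    exact_mod_cast (by linarith : (b - a) / 2 ≠ 0)
  have h1 : w + 1 / w = v + 1 / v := mul_left_cancel₀ hr (add_left_cancel h)
  have h2 : (w - v) * (w * v - 1) = 0 := by
    field_simp at h1
    linear_combination h1
  rcases mul_eq_zero.mp h2 with h3 | h3
  · exact sub_eq_zero.mp h3
  · exfalso
    have h4 : ‖w * v‖ = 1 := by rw [sub_eq_zero.mp h3]; simp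
    rw [norm_mul] at h4
    nlinarith

/-- If `w + 1/w` is a real number in `[-2, 2]`, then `|w| ≤ 1`. -/
theorem norm_le_one_of_add_inv {w : ℂ} {s : ℝ} (hs : |s| ≤ 2) (h : w + 1 / w = (s : ℂ)) :
    ‖w‖ ≤ 1 := by
  by_contra! hw
  have hw0 : w ≠ 0 := by rintro rfl; simp at hw; linarith
  have hq : w * w + 1 = s * w := by field_simp at h; linear_combination h
  have hre := congrArg Complex.re hq
  have him := congrArg Complex.im hq
  simp at hre him
  have hn : 1 < w.re * w.re + w.im * w.im := by
    have := Complex.normSq_eq_norm_sq w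
    rw [Complex.normSq_apply] at this
    nlinarith
  obtain ⟨hs1, hs2⟩ := abs_le.mp hs
  by_cases hi : w.im = 0
  · rw [hi] at hre hn
    rcases le_total 0 w.re with hp | hp
    · have : 1 < w.re := by nlinarith
      nlinarith
    · have : w.re < -1 := by nlinarith
      nlinarith
  · have : s = 2 * w.re := by
      have h5 : (2 * w.re - s) * w.im = 0 := by linarith
      rcases mul_eq_zero.mp h5 with h6 | h6
      · linarith
      · exact absurd h6 hi
    rw [this] at hre
    nlinarith

/-- `Ψ` maps the exterior of the closed unit disk bijectively onto the complement of `[a, b]`. -/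
theorem psi_bijOn {a b : ℝ} (hab : a < b) :
    Set.BijOn (Psi a b) {w : ℂ | 1 < ‖w‖} (segmentC a b)ᶜ := by
  have hr : ((((b - a) / 2 : ℝ) : ℂ)) ≠ 0 := by
    exact_mod_cast (by linarith : (b - a) / 2 ≠ 0)
  refine ⟨?_, psi_injOn hab, ?_⟩
  · rintro w hw ⟨t, ht, h⟩
    simp only [Set.mem_ofPred_eq] at hw
    have hb : 0 < b - a := by linarith
    have h1 : w + 1 / w = (((t - (a + b) / 2) / ((b - a) / 4) : ℝ) : ℂ) := by
      have hr' : ((b : ℂ) - a) ≠ 0 := by exact_mod_cast hb.ne'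
      have h' : (t : ℂ) = Psi a b w := h
      rw [Complex.ofReal_div, Complex.ofReal_sub, h']
      simp only [Psi]
      push_cast
      field_simp
      ring
    have h2 : |(t - (a + b) / 2) / ((b - a) / 4)| ≤ 2 := by
      rw [abs_div, abs_of_pos (by linarith : 0 < (b - a) / 4), div_le_iff₀ (by linarith), abs_le]
      constructor <;> linarith [ht.1, ht.2]
    exact absurd (norm_le_one_of_add_inv h2 h1) (not_le.mpr hw)
  · intro z hz
    obtain ⟨d, hd⟩ := IsAlgClosed.exists_pow_nat_eq
      (((z - (((a + b) / 2 : ℝ) : ℂ)) / (((b - a) / 2 : ℝ) : ℂ)) ^ 2 - 1) (n := 2) (by norm_num)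
    set ζ : ℂ := (z - (((a + b) / 2 : ℝ) : ℂ)) / (((b - a) / 2 : ℝ) : ℂ) with hζ
    have hprod : (ζ + d) * (ζ - d) = 1 := by linear_combination -hd
    have hz' : z = (((a + b) / 2 : ℝ) : ℂ) + (((b - a) / 2 : ℝ) : ℂ) * ζ := by
      rw [hζ]; field_simp; ring
    have key : ∀ w v : ℂ, w * v = 1 → w + v = 2 * ζ → Psi a b w = z := by
      intro w v hwv hs
      have hv : 1 / w = v := by
        have hw0 : w ≠ 0 := by rintro rfl; simp at hwv
        field_simp; linear_combination -hwv
      rw [Psi, hv, hs, hz']; ring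
    rcases lt_trichotomy ‖ζ + d‖ 1 with hlt | heq | hgt
    · refine ⟨ζ - d, ?_, key _ (ζ + d) (by linear_combination hprod) (by ring)⟩
      simp only [Set.mem_ofPred_eq]
      have hn : ‖ζ + d‖ * ‖ζ - d‖ = 1 := by rw [← norm_mul, hprod]; simp
      nlinarith [norm_nonneg (ζ - d), norm_nonneg (ζ + d)]
    · exfalso
      apply hz
      have hconj : ζ - d = (starRingEnd ℂ) (ζ + d) := by
        have h0 : ζ + d ≠ 0 := by intro h0; rw [h0] at heq; simp at heq
        apply mul_left_cancel₀ h0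
        rw [hprod, Complex.mul_conj, Complex.normSq_eq_norm_sq, heq]; simp
      have hζr : ζ = (((ζ + d).re : ℝ) : ℂ) := by
        have h7 := Complex.add_conj (ζ + d)
        rw [← hconj] at h7
        push_cast at h7
        linear_combination h7 / 2
      have habs := Complex.abs_re_le_norm (ζ + d)
      rw [heq] at habs
      obtain ⟨h8, h9⟩ := abs_le.mp habs
      refine ⟨(a + b) / 2 + (b - a) / 2 * (ζ + d).re, ⟨by nlinarith, by nlinarith⟩, ?_⟩
      change (((a + b) / 2 + (b - a) / 2 * (ζ + d).re : ℝ) : ℂ) = z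
      rw [Complex.ofReal_add, Complex.ofReal_mul, ← hζr, ← hz']
    · exact ⟨ζ + d, hgt, key _ (ζ - d) hprod (by ring)⟩

theorem psi_phi {a b : ℝ} (hab : a < b) {z : ℂ} (hz : z ∉ segmentC a b) :
    1 < ‖Phi a b z‖ ∧ Psi a b (Phi a b z) = z := by
  have h := (psi_bijOn hab).surjOn hz
  exact ⟨Function.invFunOn_mem h, Function.invFunOn_eq h⟩

theorem phi_eq {a b : ℝ} (hab : a < b) {z w : ℂ} (hw : 1 < ‖w‖) (h : Psi a b w = z) :
    Phi a b z = w := by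
  have hz : z ∉ segmentC a b := by
    rw [← h]; exact (psi_bijOn hab).mapsTo hw
  exact psi_injOn hab (psi_phi hab hz).1 hw ((psi_phi hab hz).2.trans h.symm)

theorem ofReal_notMem {a b t : ℝ} (ht : t ∉ Set.Icc a b) : (t : ℂ) ∉ segmentC a b := by
  rintro ⟨s, hs, h⟩
  exact ht (Complex.ofReal_injective h ▸ hs)

/-- `Φ` is real on the real line outside `[a, b]`. -/
theorem conj_phi {a b : ℝ} (hab : a < b) {t : ℝ} (ht : t ∉ Set.Icc a b) :
    (starRingEnd ℂ) (Phi a b t) = Phi a b t := by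
  obtain ⟨h1, h2⟩ := psi_phi hab (ofReal_notMem ht)
  refine (phi_eq hab (by rwa [Complex.norm_conj]) ?_).symm
  have h3 := congrArg (starRingEnd ℂ) h2
  simp only [Psi, map_add, map_mul, map_div₀, map_one, Complex.conj_ofReal, map_ofNat] at h3
  exact h3

/-- For `0 < a < b` and `σ` outside `[-b, -a]`, the number `B(Φ(-σ)⁻¹)` is real, equal to `E(σ)`. -/
theorem ofReal_E {a b : ℝ} (ha : 0 < a) (hab : a < b) {σ : ℝ} (hσ : σ ∉ Set.Icc (-b) (-a)) :
    (E a b σ : ℂ) = B a b (Phi a b (-(σ : ℂ)))⁻¹ := by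
  have h1 := conj_phi hab (t := -σ) (fun h => hσ ⟨by linarith [h.2], by linarith [h.1]⟩)
  have h2 := conj_phi hab (t := 0) (fun h => absurd h.1 (not_le.mpr ha))
  rw [Complex.ofReal_neg] at h1
  rw [Complex.ofReal_zero] at h2
  apply Complex.conj_eq_iff_re.mp
  simp [B, h1, h2]

/-- If `-σ` is not an eigenvalue of `A`, then `x(σ)` solves `(A + σ I) x = b`. -/
theorem shiftedSol_spec {n : ℕ} (A : Matrix (Fin n) (Fin n) ℝ) (b : EuclideanSpace ℝ (Fin n))
    {σ : ℝ} (h : -σ ∉ spectrum ℝ A) :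
    Matrix.toEuclideanLin (A + σ • (1 : Matrix (Fin n) (Fin n) ℝ)) (shiftedSol A b σ) = b := by
  have h1 : IsUnit (A + σ • (1 : Matrix (Fin n) (Fin n) ℝ)) := by
    have h2 := (spectrum.notMem_iff.mp h).neg
    rwa [neg_sub, Algebra.algebraMap_eq_smul_one, neg_smul, sub_neg_eq_add] at h2
  have h3 := Matrix.mul_nonsing_inv _ ((Matrix.isUnit_iff_isUnit_det _).mp h1)
  rw [shiftedSol]
  generalize A + σ • (1 : Matrix (Fin n) (Fin n) ℝ) = M at h3
  apply WithLp.ofLp_injective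
  simp [Matrix.toLpLin_apply, Matrix.mulVec_mulVec, h3]

end EKS

namespace EKS

/-! `Φ(0)` is real, so `B(1/w) = 1/B(w)` and `(B + 1/B)/2` is a function of `z = Ψ(w)`. Its only
poles, at `0` and `∞`, are simple, so it is a Laurent polynomial `r(z) = αz + β + γ/z`, called
`symbol`. On `|w| = 1`, that is on `[a, b]`, it equals `Re B` and so lies in `[-1, 1]`, while `r(-σ)
= (E + 1/E)/2` (`E_add_inv`).

Hence `T_k(r(z))` is at most `1` on the spectrum and at least `|E|^(-k)/2` in modulus at `-σ`. The
function `(1 - T_k(r(z)) / T_k(r(-σ))) / (z + σ)` is a Laurent polynomial with exponents from `-k`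
to `k - 1`, which is what `K_{2k}` contains. Applied to `b`, it approximates `x(σ)` with error at
most `2 |E|^k ‖b‖ / δ`, where `δ` bounds from below the distance of `-σ` to `[a, b]`
(`exists_approx`, `exists_approx_pow_abs_E`).

For `σ > 0`, AM-GM bounds `r(-σ)` from below, hence `E` from above.

Writing `a = s²`, `b = t²` keeps all formulas rational. -/

/-! ### The rate function in closed form -/

/-- The value of `Φ` at the origin. -/
theorem phi_zero {s t : ℝ} (hs : 0 < s) (hst : s < t) :
    Phi (s ^ 2) (t ^ 2) 0 = ((-((t + s) / (t - s)) : ℝ) : ℂ) := by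
  have hd : 0 < t - s := sub_pos.mpr hst
  have hp : 0 < t + s := by linarith
  refine phi_eq (by nlinarith) ?_ ?_
  · rw [Complex.norm_real, norm_neg, Real.norm_of_nonneg (by positivity), one_lt_div hd]
    linarith
  · rw [Psi, ← Complex.ofReal_zero]
    have h : (s ^ 2 + t ^ 2) / 2 + (t ^ 2 - s ^ 2) / 2 / 2 *
        (-((t + s) / (t - s)) + 1 / (-((t + s) / (t - s)))) = 0 := by
      field_simp
      ring
    rw [← h]
    push_cast
    ring

/-- Outside `[-b, -a]`, the quantities `σ` and `E(σ)` are rational functions of the real number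
`w = Φ(-σ)`. -/
theorem exists_param {s t σ : ℝ} (hs : 0 < s) (hst : s < t)
    (hσ : σ ∉ Set.Icc (-t ^ 2) (-s ^ 2)) :
    ∃ w : ℝ, 1 < |w| ∧ (t + s) * w + (t - s) ≠ 0 ∧
      σ = -(((t - s) * w + (t + s)) * ((t + s) * w + (t - s)) / (4 * w)) ∧
      E (s ^ 2) (t ^ 2) σ = -(((t - s) * w + (t + s)) / (w * ((t + s) * w + (t - s)))) := by
  have hab : s ^ 2 < t ^ 2 := by nlinarith
  have hd : 0 < t - s := sub_pos.mpr hst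
  have hmem : -σ ∉ Set.Icc (s ^ 2) (t ^ 2) :=
    fun h => hσ ⟨by linarith [h.2], by linarith [h.1]⟩
  obtain ⟨h1, h2⟩ := psi_phi hab (ofReal_notMem hmem)
  obtain ⟨w, hw⟩ := Complex.conj_eq_iff_real.mp (conj_phi hab hmem)
  rw [hw, Complex.norm_real, Real.norm_eq_abs] at h1
  have hw0 : w ≠ 0 := by
    rintro rfl
    norm_num at h1
  have hQ : (t + s) * w + (t - s) ≠ 0 := by
    intro h
    have h3 : |(t + s) * w| = t - s := by
      rw [show (t + s) * w = -(t - s) by linarith, abs_neg, abs_of_pos hd]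
    rw [abs_mul, abs_of_pos (by linarith : 0 < t + s)] at h3
    nlinarith
  refine ⟨w, h1, hQ, ?_, ?_⟩
  · rw [hw, Psi] at h2
    have h3 : (s ^ 2 + t ^ 2) / 2 + (t ^ 2 - s ^ 2) / 2 / 2 * (w + 1 / w) = -σ := by
      exact_mod_cast h2
    rw [← neg_neg σ, ← h3]
    field_simp
    ring
  · rw [E, ← Complex.ofReal_neg, hw, B, phi_zero hs hst, Complex.conj_ofReal]
    have h4 : (w : ℂ)⁻¹ * ((1 - ((-((t + s) / (t - s)) : ℝ) : ℂ) * (w : ℂ)⁻¹) /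
        (((-((t + s) / (t - s)) : ℝ) : ℂ) - (w : ℂ)⁻¹)) =
        ((w⁻¹ * ((1 - (-((t + s) / (t - s))) * w⁻¹) / (-((t + s) / (t - s)) - w⁻¹)) : ℝ) : ℂ) := by
      push_cast
      ring
    rw [h4, Complex.ofReal_re]
    have h5 : -((t + s) / (t - s)) - w⁻¹ = -((t + s) * w + (t - s)) / ((t - s) * w) := by
      field_simp
      ring
    have h6 : 1 - (-((t + s) / (t - s))) * w⁻¹ = ((t - s) * w + (t + s)) / ((t - s) * w) := by
      field_simp
      ring
    rw [h5, h6]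
    field_simp

/-- With `P`, `Q` the two linear factors in `w`, `Q² - P² = 4st(w² - 1) > 0`, and `|w| > 1` only
helps. -/
theorem abs_E_lt_one {s t σ : ℝ} (hs : 0 < s) (hst : s < t)
    (hσ : σ ∉ Set.Icc (-t ^ 2) (-s ^ 2)) : |E (s ^ 2) (t ^ 2) σ| < 1 := by
  obtain ⟨w, hw, hQ, -, hE⟩ := exists_param hs hst hσ
  have hw2 : 1 < w ^ 2 := by
    rw [← sq_abs]
    nlinarith
  have hw0 : w ≠ 0 := by
    rintro rfl
    norm_num at hw
  rw [hE, abs_neg, abs_div, div_lt_one (abs_pos.mpr (mul_ne_zero hw0 hQ)), ← sq_lt_sq]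
  have h1 : ((t - s) * w + (t + s)) ^ 2 < ((t + s) * w + (t - s)) ^ 2 := by
    have : 0 < s * t * (w ^ 2 - 1) :=
      mul_pos (mul_pos hs (hs.trans hst)) (by linarith)
    nlinarith
  rw [mul_pow]
  nlinarith [sq_nonneg ((t + s) * w + (t - s))]

/-- The Laurent polynomial `(B(w) + 1 / B(w)) / 2` of `z = Ψ(w)`. -/
noncomputable def symbol (s t z : ℝ) : ℝ :=
  -1 + 2 * (s ^ 2 + t ^ 2 - z - s ^ 2 * t ^ 2 / z) / (t - s) ^ 2

/-- The case `σ = 0` is excluded because `E` vanishes there, matching the pole of `symbol` at `0`.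
-/
theorem E_add_inv {s t σ : ℝ} (hs : 0 < s) (hst : s < t)
    (hσ : σ ∉ Set.Icc (-t ^ 2) (-s ^ 2)) (h0 : σ ≠ 0) :
    E (s ^ 2) (t ^ 2) σ ≠ 0 ∧
      (E (s ^ 2) (t ^ 2) σ + (E (s ^ 2) (t ^ 2) σ)⁻¹) / 2 = symbol s t (-σ) := by
  obtain ⟨w, hw, hQ, hσw, hE⟩ := exists_param hs hst hσ
  have hw0 : w ≠ 0 := by
    rintro rfl
    norm_num at hw
  have hd : t - s ≠ 0 := (sub_pos.mpr hst).ne'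
  have hP : (t - s) * w + (t + s) ≠ 0 := by
    intro h
    apply h0
    rw [hσw, h]
    simp
  -- The identity with denominators cleared. It is proved for the actual linear factors, which are
  -- then abstracted to atoms so that `field_simp` does not expand them.
  have hid : ∀ P Q : ℝ, P = (t - s) * w + (t + s) → Q = (t + s) * w + (t - s) →
      (P ^ 2 + w ^ 2 * Q ^ 2) * (t - s) ^ 2 = 2 * w * P * Q * (t - s) ^ 2 -
        4 * (s ^ 2 + t ^ 2) * w * P * Q + P ^ 2 * Q ^ 2 + 16 * w ^ 2 * s ^ 2 * t ^ 2 := by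
    rintro _ _ rfl rfl
    ring
  rw [hE]
  refine ⟨neg_ne_zero.mpr (div_ne_zero hP (mul_ne_zero hw0 hQ)), ?_⟩
  rw [symbol, hσw]
  replace hid := hid _ _ rfl rfl
  clear hE hσw
  generalize (t - s) * w + (t + s) = P at *
  generalize (t + s) * w + (t - s) = Q at *
  field_simp
  linear_combination -4 * hid

/-- The quotient `(z - s²)(t² - z)/z` is nonnegative on the interval and attains its maximum `(t -
s)²` at `z = st`. -/
theorem abs_symbol_le_one {s t z : ℝ} (hs : 0 < s) (hst : s < t)
    (hz : z ∈ Set.Icc (s ^ 2) (t ^ 2)) : |symbol s t z| ≤ 1 := by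
  have hz0 : 0 < z := (by positivity : 0 < s ^ 2).trans_le hz.1
  have hd : 0 < (t - s) ^ 2 := pow_pos (sub_pos.mpr hst) 2
  have h1 : s ^ 2 + t ^ 2 - z - s ^ 2 * t ^ 2 / z = (z - s ^ 2) * (t ^ 2 - z) / z := by
    field_simp
    ring
  have h2 : 0 ≤ (z - s ^ 2) * (t ^ 2 - z) / z :=
    div_nonneg (mul_nonneg (sub_nonneg.mpr hz.1) (sub_nonneg.mpr hz.2)) hz0.le
  have h3 : (z - s ^ 2) * (t ^ 2 - z) / z ≤ (t - s) ^ 2 := by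
    rw [div_le_iff₀ hz0]
    nlinarith [sq_nonneg (z - s * t)]
  rw [symbol, h1, mul_div_assoc, abs_le]
  have h4 := div_nonneg h2 hd.le
  have h5 := (div_le_one hd).mpr h3
  constructor <;> linarith

/-- AM-GM: `σ + s²t²/σ ≥ 2st`, with equality at `σ = st`. -/
theorem le_symbol_neg {s t σ : ℝ} (hst : s < t) (hσ : 0 < σ) :
    -1 + 2 * (t + s) ^ 2 / (t - s) ^ 2 ≤ symbol s t (-σ) := by
  have hd : 0 < (t - s) ^ 2 := pow_pos (sub_pos.mpr hst) 2
  have h : (t + s) ^ 2 ≤ s ^ 2 + t ^ 2 - -σ - s ^ 2 * t ^ 2 / -σ := by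
    rw [div_neg, sub_neg_eq_add, sub_neg_eq_add, ← sub_nonneg]
    have : s ^ 2 + t ^ 2 + σ + s ^ 2 * t ^ 2 / σ - (t + s) ^ 2 = (σ - s * t) ^ 2 / σ := by
      field_simp
      ring
    rw [this]
    positivity
  rw [symbol]
  gcongr

theorem le_of_add_inv_le {x y : ℝ} (hx : 0 < x) (hx1 : x < 1) (hy : 0 < y) (hy1 : y < 1)
    (h : y + y⁻¹ ≤ x + x⁻¹) : x ≤ y := by
  by_contra! hlt
  have h1 : y + y⁻¹ - (x + x⁻¹) = (x - y) * (1 - x * y) / (x * y) := by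
    field_simp
    ring
  have h2 : 0 < (x - y) * (1 - x * y) / (x * y) :=
    div_pos (mul_pos (by linarith) (by nlinarith)) (mul_pos hx hy)
  linarith

/-- For `σ ≥ 0`, the rate is at most its value at `σ = √(ab)`. -/
theorem abs_E_le_of_nonneg {p q σ : ℝ} (hp : 0 < p) (hpq : p < q) (hσ : 0 ≤ σ) :
    |E ((p ^ 2) ^ 2) ((q ^ 2) ^ 2) σ| ≤ ((q - p) / (q + p)) ^ 2 := by
  have hs : 0 < p ^ 2 := by positivity
  have hst : p ^ 2 < q ^ 2 := by nlinarith
  have hq : 0 < q := hp.trans hpq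
  have hd : 0 < q - p := sub_pos.mpr hpq
  have hmem : σ ∉ Set.Icc (-(q ^ 2) ^ 2) (-(p ^ 2) ^ 2) := fun h => by
    have : 0 < (p ^ 2) ^ 2 := by positivity
    linarith [h.2]
  rcases hσ.eq_or_lt with rfl | hσ
  · have h0 : E ((p ^ 2) ^ 2) ((q ^ 2) ^ 2) 0 = 0 := by
      obtain ⟨w, hw, hQ, hσw, hE⟩ := exists_param hs hst hmem
      have hw0 : w ≠ 0 := by
        rintro rfl
        norm_num at hw
      have hP : (q ^ 2 - p ^ 2) * w + (q ^ 2 + p ^ 2) = 0 := by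
        by_contra hP
        exact neg_ne_zero.mpr (div_ne_zero (mul_ne_zero hP hQ) (by simpa using hw0)) hσw.symm
      rw [hE, hP]
      simp
    rw [h0, abs_zero]
    positivity
  · have hE1 := abs_E_lt_one hs hst hmem
    obtain ⟨hE0, hE⟩ := E_add_inv hs hst hmem hσ.ne'
    have hle := le_symbol_neg hst hσ
    set e := E ((p ^ 2) ^ 2) ((q ^ 2) ^ 2) σ
    have hd2 : 0 < q ^ 2 - p ^ 2 := by linarith
    -- The claimed bound `R` is the root in `(0, 1)` of `R + 1/R = 2m`, where `m` is the lower bound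
    -- of `le_symbol_neg`.
    have hR : ((q - p) / (q + p)) ^ 2 + (((q - p) / (q + p)) ^ 2)⁻¹ =
        2 * (-1 + 2 * (q ^ 2 + p ^ 2) ^ 2 / (q ^ 2 - p ^ 2) ^ 2) := by
      rw [show q ^ 2 - p ^ 2 = (q - p) * (q + p) by ring]
      field_simp
      ring
    have hR0 : 0 < ((q - p) / (q + p)) ^ 2 := by positivity
    have hpos : 0 < e := by
      by_contra! hneg
      have := inv_nonpos.mpr hneg
      have := inv_pos.mpr hR0
      linarith
    rw [abs_of_pos hpos] at hE1 ⊢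
    refine le_of_add_inv_le hpos hE1 hR0 ?_ (by linarith)
    have h1 : (q - p) / (q + p) < 1 := by rw [div_lt_one (by positivity)]; linarith
    have h2 : 0 < (q - p) / (q + p) := by positivity
    nlinarith

/-! ### Chebyshev polynomials -/

theorem two_mul_chebyshev_eval_half_add_inv {e : ℝ} (he : e ≠ 0) (k : ℕ) :
    2 * (Polynomial.Chebyshev.T ℝ k).eval ((e + e⁻¹) / 2) = e ^ k + (e ^ k)⁻¹ := by
  induction k using Nat.twoStepInduction with
  | zero => norm_num
  | one => simp; ring
  | more k h1 h2 =>
    push_cast at h2 ⊢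
    rw [Polynomial.Chebyshev.T_add_two]
    simp only [Polynomial.eval_sub, Polynomial.eval_mul, Polynomial.eval_X, Polynomial.eval_ofNat]
    rw [mul_sub, h1, show ∀ x y : ℝ, 2 * (2 * x * y) = 2 * x * (2 * y) by intros; ring, h2]
    field_simp
    ring

/-- `e^k` and its inverse have the same sign, so nothing cancels in their sum, even for negative
`e`. -/
theorem inv_le_abs_chebyshev_eval {e : ℝ} (he : e ≠ 0) (k : ℕ) :
    (|e| ^ k)⁻¹ / 2 ≤ |(Polynomial.Chebyshev.T ℝ k).eval ((e + e⁻¹) / 2)| := by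
  have h := congrArg abs (two_mul_chebyshev_eval_half_add_inv he k)
  rw [abs_mul, abs_two] at h
  have h1 : |(e ^ k)⁻¹| ≤ |e ^ k + (e ^ k)⁻¹| := by
    rw [← sq_le_sq]
    have : e ^ k * (e ^ k)⁻¹ = 1 := mul_inv_cancel₀ (pow_ne_zero k he)
    nlinarith [sq_nonneg (e ^ k)]
  rw [abs_inv, abs_pow] at h1
  linarith

theorem abs_chebyshev_eval_le_one {x : ℝ} (hx : |x| ≤ 1) (k : ℕ) :
    |(Polynomial.Chebyshev.T ℝ k).eval x| ≤ 1 := by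
  obtain ⟨h1, h2⟩ := abs_le.mp hx
  rw [← Real.cos_arccos h1 h2, Polynomial.Chebyshev.T_real_cos]
  exact Real.abs_cos_le_one _

/-! ### Extended Krylov subspaces -/

section Krylov

variable {n : ℕ} {A : Matrix (Fin n) (Fin n) ℝ} {b : EuclideanSpace ℝ (Fin n)}

theorem krylovVec_mem {i j : ℕ} (h : i < j) : krylovVec A b i ∈ extKrylov A b j :=
  Submodule.subset_span ⟨i, h, rfl⟩

theorem krylovVec_two_mul (k : ℕ) :
    krylovVec A b (2 * k) = Matrix.toEuclideanLin (A ^ k) b := by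
  simp [krylovVec]

theorem krylovVec_two_mul_add_one (k : ℕ) :
    krylovVec A b (2 * k + 1) = Matrix.toEuclideanLin (A⁻¹ ^ (k + 1)) b := by
  rw [krylovVec, if_neg (by simp), show (2 * k + 1 + 1) / 2 = k + 1 by omega]

theorem extKrylov_mono {i j : ℕ} (h : i ≤ j) : extKrylov A b i ≤ extKrylov A b j :=
  Submodule.span_mono (Set.image_mono (Set.Iio_subset_Iio h))

theorem map_mem_of_krylovVec {f : EuclideanSpace ℝ (Fin n) →ₗ[ℝ] EuclideanSpace ℝ (Fin n)}
    {i : ℕ} {V : Submodule ℝ (EuclideanSpace ℝ (Fin n))}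
    (h : ∀ l < i, f (krylovVec A b l) ∈ V) {x : EuclideanSpace ℝ (Fin n)}
    (hx : x ∈ extKrylov A b i) : f x ∈ V := by
  have : extKrylov A b i ≤ V.comap f := by
    rw [extKrylov, Submodule.span_le]
    rintro _ ⟨l, hl, rfl⟩
    exact h l hl
  exact this hx

theorem toEuclideanLin_mul_apply (M N : Matrix (Fin n) (Fin n) ℝ) (x : EuclideanSpace ℝ (Fin n)) :
    Matrix.toEuclideanLin M (Matrix.toEuclideanLin N x) = Matrix.toEuclideanLin (M * N) x := by
  simp

/-- Multiplication by `A` raises even indices by two and lowers odd ones by two, except that `A⁻¹b`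
goes to `b`. -/
theorem toEuclideanLin_krylovVec (hA : IsUnit A.det) (l : ℕ) :
    Matrix.toEuclideanLin A (krylovVec A b l) ∈ extKrylov A b (l + 3) := by
  obtain ⟨k, rfl | rfl⟩ := Nat.even_or_odd' l
  · rw [krylovVec_two_mul, toEuclideanLin_mul_apply, ← pow_succ', ← krylovVec_two_mul]
    exact krylovVec_mem (by omega)
  · rw [krylovVec_two_mul_add_one, toEuclideanLin_mul_apply, pow_succ', ← mul_assoc,
      Matrix.mul_nonsing_inv _ hA, one_mul]
    cases k with
    | zero =>
      rw [pow_zero, ← pow_zero A, ← krylovVec_two_mul]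
      exact krylovVec_mem (by omega)
    | succ k =>
      rw [← krylovVec_two_mul_add_one]
      exact krylovVec_mem (by omega)

/-- The first `2m + 1` vectors carry the exponents `-m, …, m`, so applying `A⁻¹` costs only one new
vector, `A^(-m-1) b`. -/
theorem toEuclideanLin_inv_krylovVec (hA : IsUnit A.det) {l m : ℕ} (hl : l < 2 * m + 1) :
    Matrix.toEuclideanLin A⁻¹ (krylovVec A b l) ∈ extKrylov A b (2 * m + 2) := by
  obtain ⟨k, rfl | rfl⟩ := Nat.even_or_odd' l
  · rw [krylovVec_two_mul, toEuclideanLin_mul_apply]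
    cases k with
    | zero =>
      rw [pow_zero, mul_one, ← pow_one A⁻¹, ← zero_add 1, ← krylovVec_two_mul_add_one]
      exact krylovVec_mem (by omega)
    | succ k =>
      rw [pow_succ', ← mul_assoc, Matrix.nonsing_inv_mul _ hA, one_mul, ← krylovVec_two_mul]
      exact krylovVec_mem (by omega)
  · rw [krylovVec_two_mul_add_one, toEuclideanLin_mul_apply, ← pow_succ',
      ← krylovVec_two_mul_add_one]
    exact krylovVec_mem (by omega)

/-- The operator `α A + β + γ A⁻¹`. -/
noncomputable def laurentOp (A : Matrix (Fin n) (Fin n) ℝ) (α β γ : ℝ) :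
    Module.End ℝ (EuclideanSpace ℝ (Fin n)) :=
  α • Matrix.toEuclideanLin A + β • LinearMap.id + γ • Matrix.toEuclideanLin A⁻¹

theorem laurentOp_pow_mem (hA : IsUnit A.det) (α β γ : ℝ) (m : ℕ) :
    (laurentOp A α β γ ^ m) b ∈ extKrylov A b (2 * m + 1) := by
  induction m with
  | zero => simpa [krylovVec] using krylovVec_mem (A := A) (b := b) zero_lt_one
  | succ m ih =>
    rw [pow_succ', Module.End.mul_apply]
    refine add_mem (add_mem ?_ ?_) ?_
    · exact Submodule.smul_mem _ _ (map_mem_of_krylovVec (fun l hl =>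
        extKrylov_mono (by omega) (toEuclideanLin_krylovVec hA l)) ih)
    · exact Submodule.smul_mem _ _ (extKrylov_mono (by omega) ih)
    · exact Submodule.smul_mem _ _ (map_mem_of_krylovVec (fun l hl =>
        extKrylov_mono (by omega) (toEuclideanLin_inv_krylovVec hA hl)) ih)

theorem aeval_laurentOp_mem (hA : IsUnit A.det) (α β γ : ℝ) {p : Polynomial ℝ} {m : ℕ}
    (hp : p.natDegree ≤ m) :
    Polynomial.aeval (laurentOp A α β γ) p b ∈ extKrylov A b (2 * m + 1) := by
  rw [Polynomial.aeval_eq_sum_range, LinearMap.sum_apply]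
  refine Submodule.sum_mem _ fun i hi => Submodule.smul_mem _ _ ?_
  exact extKrylov_mono (by simp at hi; omega) (laurentOp_pow_mem hA α β γ i)

end Krylov

/-! ### Spectral bounds -/

theorem norm_apply_le_of_eigenbasis {ι V : Type*} [Fintype ι] [NormedAddCommGroup V]
    [InnerProductSpace ℝ V] (v : OrthonormalBasis ι ℝ V) (D : V →ₗ[ℝ] V) {d : ι → ℝ} {K : ℝ}
    (hD : ∀ i, D (v i) = d i • v i) (hK : 0 ≤ K) (hd : ∀ i, |d i| ≤ K) (x : V) :
    ‖D x‖ ≤ K * ‖x‖ := by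
  have hr : ∀ i, inner ℝ (v i) (D x) = d i * inner ℝ (v i) x := by
    intro i
    conv_lhs => rw [← v.sum_repr x]
    simp only [map_sum, map_smul, hD, smul_smul]
    rw [v.orthonormal.inner_right_fintype, v.repr_apply_apply, mul_comm]
  refine le_of_sq_le_sq ?_ (by positivity)
  rw [mul_pow, ← v.sum_sq_inner_right, ← v.sum_sq_inner_right x, Finset.mul_sum]
  refine Finset.sum_le_sum fun i _ => ?_
  rw [hr, mul_pow]
  exact mul_le_mul_of_nonneg_right (sq_le_sq.mpr ((hd i).trans (le_abs_self K))) (sq_nonneg _)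

theorem toEuclideanLin_nonsing_inv_apply {n : ℕ} {M : Matrix (Fin n) (Fin n) ℝ} (hM : IsUnit M.det)
    {v : EuclideanSpace ℝ (Fin n)} {l : ℝ} (hl : l ≠ 0) (hv : Matrix.toEuclideanLin M v = l • v) :
    Matrix.toEuclideanLin M⁻¹ v = l⁻¹ • v := by
  have h : Matrix.toEuclideanLin M⁻¹ (Matrix.toEuclideanLin M v) = v := by
    rw [toEuclideanLin_mul_apply, Matrix.nonsing_inv_mul _ hM]
    simp
  rw [hv, map_smul] at h
  rw [← h, smul_smul, inv_mul_cancel₀ hl, one_smul, h]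

theorem isUnit_det_add_smul_one {n : ℕ} {A : Matrix (Fin n) (Fin n) ℝ} {σ : ℝ}
    (h : -σ ∉ spectrum ℝ A) : IsUnit (A + σ • (1 : Matrix (Fin n) (Fin n) ℝ)).det := by
  have h2 := (spectrum.notMem_iff.mp h).neg
  rw [neg_sub, Algebra.algebraMap_eq_smul_one, neg_smul, sub_neg_eq_add] at h2
  exact (Matrix.isUnit_iff_isUnit_det _).mp h2

/-! ### Interpolation of the resolvent at `-σ` -/

section Approximation

variable {n : ℕ} {A : Matrix (Fin n) (Fin n) ℝ} {b : EuclideanSpace ℝ (Fin n)}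

theorem toEuclideanLin_eigenvectorBasis (hA : A.IsHermitian) (i : Fin n) :
    Matrix.toEuclideanLin A (hA.eigenvectorBasis i) = hA.eigenvalues i • hA.eigenvectorBasis i := by
  apply WithLp.ofLp_injective
  simpa [Matrix.toLpLin_apply] using hA.mulVec_eigenvectorBasis i

theorem toEuclideanLin_shifted_inv_eigenvectorBasis (hA : A.IsHermitian) {σ : ℝ}
    (hσ : -σ ∉ spectrum ℝ A) (i : Fin n) :
    Matrix.toEuclideanLin (A + σ • (1 : Matrix (Fin n) (Fin n) ℝ))⁻¹ (hA.eigenvectorBasis i) =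
      (hA.eigenvalues i + σ)⁻¹ • hA.eigenvectorBasis i := by
  refine toEuclideanLin_nonsing_inv_apply (isUnit_det_add_smul_one hσ) ?_ ?_
  · intro h
    apply hσ
    rw [← eq_neg_of_add_eq_zero_left h]
    exact hA.eigenvalues_mem_spectrum_real i
  · rw [map_add, LinearMap.add_apply, toEuclideanLin_eigenvectorBasis, map_smul, add_smul]
    simp

theorem norm_shiftedSol_le (hA : A.PosDef) {σ δ : ℝ} (hδ : 0 < δ)
    (hσA : ∀ z ∈ spectrum ℝ A, δ ≤ |z + σ|) : ‖shiftedSol A b σ‖ ≤ δ⁻¹ * ‖b‖ := by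
  have hσ : -σ ∉ spectrum ℝ A := fun h => by
    have := hσA _ h
    rw [neg_add_cancel, abs_zero] at this
    linarith
  refine norm_apply_le_of_eigenbasis hA.1.eigenvectorBasis _
    (toEuclideanLin_shifted_inv_eigenvectorBasis hA.1 hσ) (by positivity) (fun i => ?_) b
  rw [abs_inv]
  exact inv_anti₀ hδ (hσA _ (hA.1.eigenvalues_mem_spectrum_real i))

/-- If `p(α z + β + γ / z)` is at most `1` in modulus on the spectrum of `A`, then interpolation at
`-σ` gives an element of the extended Krylov subspace close to `x(σ)`. -/
theorem exists_approx (hA : A.PosDef) {σ δ : ℝ} (α β γ : ℝ) (hσ : σ ≠ 0) (hδ : 0 < δ)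
    (hσA : ∀ z ∈ spectrum ℝ A, δ ≤ |z + σ|) {p : Polynomial ℝ} {m : ℕ}
    (hp : p.natDegree ≤ m + 1)
    (hpA : ∀ z ∈ spectrum ℝ A, |p.eval (α * z + β + γ * z⁻¹)| ≤ 1)
    (hg : p.eval (α * (-σ) + β + γ * (-σ)⁻¹) ≠ 0) :
    ∃ x ∈ extKrylov A b (2 * (m + 1)),
      ‖shiftedSol A b σ - x‖ ≤ (δ * |p.eval (α * (-σ) + β + γ * (-σ)⁻¹)|)⁻¹ * ‖b‖ := by
  have hσ' : -σ ∉ spectrum ℝ A := fun h => by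
    have := hσA _ h
    rw [neg_add_cancel, abs_zero] at this
    linarith
  have hdet : IsUnit A.det := hA.det_pos.ne'.isUnit
  set r := α * (-σ) + β + γ * (-σ)⁻¹ with hr
  set g := p.eval r
  set q := p /ₘ (Polynomial.X - Polynomial.C r)
  have hpq : ∀ y, p.eval y = (y - r) * q.eval y + g := by
    intro y
    have h := congrArg (Polynomial.eval y)
      (Polynomial.modByMonic_add_div p (Polynomial.X - Polynomial.C r))
    rw [Polynomial.modByMonic_X_sub_C_eq_C_eval] at h
    simp only [Polynomial.eval_add, Polynomial.eval_mul, Polynomial.eval_sub, Polynomial.eval_X,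
      Polynomial.eval_C] at h
    rw [← h, add_comm]
  have hq : q.natDegree ≤ m := by
    rw [Polynomial.natDegree_divByMonic _ (Polynomial.monic_X_sub_C r),
      Polynomial.natDegree_X_sub_C]
    omega
  -- Since `p(y) = (y - r) q(y) + g` and `r(z) - r(-σ) = (z + σ)(α + γ/(σz))`, the quotient `(1 -
  -- p(r(z))/g)/(z + σ)` is `-g⁻¹ (α + γσ⁻¹z⁻¹) q(r(z))`. The factor besides `q` involves only `1`
  -- and `z⁻¹`, so `K_{2m+2}` suffices.
  set D : Module.End ℝ (EuclideanSpace ℝ (Fin n)) :=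
    (-g⁻¹) • ((α • LinearMap.id + (γ * σ⁻¹) • Matrix.toEuclideanLin A⁻¹) ∘ₗ
      Polynomial.aeval (laurentOp A α β γ) q) with hDdef
  refine ⟨D b, ?_, ?_⟩
  · have hmem := aeval_laurentOp_mem (b := b) hdet α β γ hq
    refine Submodule.smul_mem _ _ (add_mem ?_ ?_)
    · exact Submodule.smul_mem _ _ (extKrylov_mono (by omega) hmem)
    · exact Submodule.smul_mem _ _ (map_mem_of_krylovVec
        (fun l hl => toEuclideanLin_inv_krylovVec hdet hl) hmem)
  · have heig : ∀ i, (Matrix.toEuclideanLin (A + σ • (1 : Matrix (Fin n) (Fin n) ℝ))⁻¹ - D)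
        (hA.1.eigenvectorBasis i) =
        (p.eval (α * hA.1.eigenvalues i + β + γ * (hA.1.eigenvalues i)⁻¹) /
          ((hA.1.eigenvalues i + σ) * g)) • hA.1.eigenvectorBasis i := by
      intro i
      have hR := toEuclideanLin_shifted_inv_eigenvectorBasis hA.1 hσ' i
      have hT := toEuclideanLin_eigenvectorBasis hA.1 i
      have hl : hA.1.eigenvalues i ≠ 0 := (hA.eigenvalues_pos i).ne'
      have hl2 : hA.1.eigenvalues i + σ ≠ 0 := fun h => by
        apply hσ'
        rw [← eq_neg_of_add_eq_zero_left h]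
        exact hA.1.eigenvalues_mem_spectrum_real i
      have hS := toEuclideanLin_nonsing_inv_apply hdet hl hT
      generalize hA.1.eigenvalues i = l at *
      generalize hA.1.eigenvectorBasis i = v at *
      have hM : laurentOp A α β γ v = (α * l + β + γ * l⁻¹) • v := by
        simp only [laurentOp, LinearMap.add_apply, LinearMap.smul_apply, LinearMap.id_apply,
          hT, hS, smul_smul, add_smul]
      rw [LinearMap.sub_apply, hR, hDdef]
      simp only [LinearMap.smul_apply, LinearMap.comp_apply, LinearMap.add_apply,
        LinearMap.id_apply, Module.End.aeval_apply_of_mem_apply_eq_smul hM, map_smul, hS,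
        smul_smul, ← add_smul, ← sub_smul]
      congr 1
      rw [hpq, hr]
      field_simp
      ring
    have hb := norm_apply_le_of_eigenbasis hA.1.eigenvectorBasis _ heig
      (K := (δ * |g|)⁻¹) (by positivity) (fun i => ?_) b
    · exact hb
    · have hmem := hA.1.eigenvalues_mem_spectrum_real i
      rw [abs_div, abs_mul, ← one_div (δ * |g|)]
      have hg' : 0 < |g| := abs_pos.mpr hg
      exact div_le_div₀ zero_le_one (hpA _ hmem) (by positivity)
        (mul_le_mul_of_nonneg_right (hσA _ hmem) hg'.le)

end Approximation

/-- Approximation of `x(σ)` from the extended Krylov space of even index at the rate `|E(σ)|`. -/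
theorem exists_approx_pow_abs_E {s t σ δ : ℝ} (hs : 0 < s) (hst : s < t) (hδ : 0 < δ)
    (hσδ : ∀ z ∈ Set.Icc (s ^ 2) (t ^ 2), δ ≤ |z + σ|) {n : ℕ} {A : Matrix (Fin n) (Fin n) ℝ}
    (b : EuclideanSpace ℝ (Fin n)) (hA : A.PosDef)
    (hspec : spectrum ℝ A ⊆ Set.Icc (s ^ 2) (t ^ 2)) (k : ℕ) :
    ∃ x ∈ extKrylov A b (2 * k),
      ‖shiftedSol A b σ - x‖ ≤ 2 / δ * ‖b‖ * |E (s ^ 2) (t ^ 2) σ| ^ k := by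
  have hσA : ∀ z ∈ spectrum ℝ A, δ ≤ |z + σ| := fun z hz => hσδ z (hspec hz)
  cases k with
  | zero =>
    refine ⟨0, zero_mem _, ?_⟩
    rw [sub_zero, pow_zero, mul_one, div_eq_mul_inv]
    refine (norm_shiftedSol_le hA hδ hσA).trans ?_
    gcongr
    linarith [inv_pos.mpr hδ]
  | succ m =>
    -- At `σ = 0` the symbol has its pole, but `x(0) = A⁻¹b` already lies in `K_2`, so the error is
    -- zero.
    rcases eq_or_ne σ 0 with rfl | hσ0
    · refine ⟨shiftedSol A b 0, ?_, ?_⟩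
      · rw [shiftedSol, zero_smul, add_zero, ← pow_one A⁻¹, ← zero_add 1,
          ← krylovVec_two_mul_add_one]
        exact krylovVec_mem (by omega)
      · rw [sub_self, norm_zero]
        positivity
    · have hσ : σ ∉ Set.Icc (-t ^ 2) (-s ^ 2) := fun h => by
        have := hσδ (-σ) ⟨by linarith [h.2], by linarith [h.1]⟩
        rw [neg_add_cancel, abs_zero] at this
        linarith
      obtain ⟨hE0, hE⟩ := E_add_inv hs hst hσ hσ0
      have hsym : ∀ z, symbol s t z = -2 / (t - s) ^ 2 * z +
          (-1 + 2 * (s ^ 2 + t ^ 2) / (t - s) ^ 2) +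
          -2 * (s ^ 2 * t ^ 2) / (t - s) ^ 2 * z⁻¹ := by
        intro z
        rw [symbol]
        ring
      have hle := inv_le_abs_chebyshev_eval hE0 (m + 1)
      have hEpos : 0 < |E (s ^ 2) (t ^ 2) σ| ^ (m + 1) := pow_pos (abs_pos.mpr hE0) _
      have hgpos := (by positivity : 0 < (|E (s ^ 2) (t ^ 2) σ| ^ (m + 1))⁻¹ / 2).trans_le hle
      rw [hE, hsym] at hle hgpos
      obtain ⟨x, hx, hxle⟩ := exists_approx (b := b) hA _ _ _ hσ0 hδ hσA
        (p := Polynomial.Chebyshev.T ℝ ((m + 1 : ℕ) : ℤ)) (m := m)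
        (by rw [Polynomial.Chebyshev.natDegree_T, Int.natAbs_natCast])
        (fun z hz => by
          rw [← hsym]
          exact abs_chebyshev_eval_le_one (abs_symbol_le_one hs hst (hspec hz)) (m + 1))
        (abs_pos.mp hgpos)
      refine ⟨x, hx, hxle.trans ?_⟩
      rw [mul_right_comm]
      refine mul_le_mul_of_nonneg_right ?_ (norm_nonneg b)
      calc _ ≤ (δ * ((|E (s ^ 2) (t ^ 2) σ| ^ (m + 1))⁻¹ / 2))⁻¹ :=
            inv_anti₀ (by positivity) (mul_le_mul_of_nonneg_left hle hδ.le)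
        _ = _ := by field_simp

/-! ### From `|E|` to the rate `μ` -/

theorem rate_pow_two_mul (a b σ : ℝ) (k : ℕ) : rate a b σ ^ (2 * k) = |E a b σ| ^ k := by
  rw [pow_mul, rate, Real.sq_sqrt (abs_nonneg _)]

theorem rate_pos {s t σ : ℝ} (hs : 0 < s) (hst : s < t)
    (hσ : σ ∉ Set.Icc (-t ^ 2) (-s ^ 2)) (h0 : σ ≠ 0) : 0 < rate (s ^ 2) (t ^ 2) σ :=
  Real.sqrt_pos.mpr (abs_pos.mpr (E_add_inv hs hst hσ h0).1)

theorem rate_le_of_nonneg {a b σ : ℝ} (ha : 0 < a) (hab : a < b) (hσ : 0 ≤ σ) :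
    rate a b σ ≤ ((b / a) ^ (1 / 4 : ℝ) - 1) / ((b / a) ^ (1 / 4 : ℝ) + 1) := by
  -- Fourth roots `p`, `q` of `a`, `b` give `κ^(1/4) = q/p` and make the bound rational.
  obtain ⟨p, hp, rfl⟩ : ∃ p : ℝ, 0 < p ∧ (p ^ 2) ^ 2 = a :=
    ⟨√√a, by positivity, by rw [Real.sq_sqrt (by positivity), Real.sq_sqrt ha.le]⟩
  obtain ⟨q, hq, rfl⟩ : ∃ q : ℝ, 0 < q ∧ (q ^ 2) ^ 2 = b :=
    ⟨√√b, Real.sqrt_pos.mpr (Real.sqrt_pos.mpr (ha.trans hab)),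
      by rw [Real.sq_sqrt (by positivity), Real.sq_sqrt (ha.trans hab).le]⟩
  have hpq : p < q := by
    rw [← pow_mul, ← pow_mul] at hab
    exact lt_of_pow_lt_pow_left₀ _ hq.le hab
  have hroot : ((q ^ 2) ^ 2 / (p ^ 2) ^ 2) ^ (1 / 4 : ℝ) = q / p := by
    rw [← pow_mul, ← pow_mul, ← div_pow, one_div]
    exact_mod_cast Real.pow_rpow_inv_natCast (div_pos hq hp).le (n := 4) (by norm_num)
  have h : (q / p - 1) / (q / p + 1) = (q - p) / (q + p) := by
    field_simp
  rw [hroot, h, rate]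
  exact Real.sqrt_le_iff.mpr
    ⟨div_nonneg (sub_nonneg.mpr hpq.le) (by positivity), abs_E_le_of_nonneg hp hpq hσ⟩

end EKS

theorem mainTheorem1 (lam1 lamn δ1 δn : ℝ) (hlam1 : 0 < lam1) (hlam : lam1 < lamn)
    (hδ1 : 0 < δ1) (hδn : 0 < δn) :
    ∃ C : ℝ, 0 < C ∧ ∀ σ : ℝ, σ ∉ Set.Ioo (-lamn - δn) (-lam1 + δ1) →
      EKS.rate lam1 lamn σ < 1 ∧
      (∀ (n : ℕ) (A : Matrix (Fin n) (Fin n) ℝ) (b : EuclideanSpace ℝ (Fin n)),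
        A.PosDef → spectrum ℝ A ⊆ Set.Icc lam1 lamn →
        ∀ j : ℕ, ∃ x ∈ EKS.extKrylov A b j,
          ‖EKS.shiftedSol A b σ - x‖ ≤ C * ‖b‖ * EKS.rate lam1 lamn σ ^ (2 * (j / 2)) ∧
          (σ ≠ 0 → ‖EKS.shiftedSol A b σ - x‖ ≤
            C * ‖b‖ / EKS.rate lam1 lamn σ * EKS.rate lam1 lamn σ ^ j)) ∧
      (0 ≤ σ → EKS.rate lam1 lamn σ ≤
        ((lamn / lam1) ^ (1 / 4 : ℝ) - 1) / ((lamn / lam1) ^ (1 / 4 : ℝ) + 1)) := by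
  obtain ⟨s, hs, rfl⟩ : ∃ s : ℝ, 0 < s ∧ s ^ 2 = lam1 :=
    ⟨√lam1, Real.sqrt_pos.mpr hlam1, Real.sq_sqrt hlam1.le⟩
  obtain ⟨t, ht, rfl⟩ : ∃ t : ℝ, 0 < t ∧ t ^ 2 = lamn :=
    ⟨√lamn, Real.sqrt_pos.mpr (hlam1.trans hlam), Real.sq_sqrt (hlam1.trans hlam).le⟩
  have hst : s < t := lt_of_pow_lt_pow_left₀ _ ht.le hlam
  have hδ : 0 < min δ1 δn := lt_min hδ1 hδn
  -- The `2` comes from the Chebyshev lower bound; the minimum bounds the distance from `-σ` to the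
  -- spectral interval.
  refine ⟨2 / min δ1 δn, by positivity, fun σ hσ => ?_⟩
  have hσδ : ∀ z ∈ Set.Icc (s ^ 2) (t ^ 2), min δ1 δn ≤ |z + σ| := by
    intro z hz
    by_contra! h
    obtain ⟨h1, h2⟩ := abs_lt.mp h
    exact hσ ⟨by linarith [hz.2, min_le_right δ1 δn], by linarith [hz.1, min_le_left δ1 δn]⟩
  have hσ' : σ ∉ Set.Icc (-t ^ 2) (-s ^ 2) :=
    fun h => hσ ⟨by linarith [h.1], by linarith [h.2]⟩
  have hrate : EKS.rate (s ^ 2) (t ^ 2) σ < 1 := by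
    rw [EKS.rate, Real.sqrt_lt' (zero_lt_one : (0 : ℝ) < 1), one_pow]
    exact EKS.abs_E_lt_one hs hst hσ'
  refine ⟨hrate, fun n A b hA hspec j => ?_, EKS.rate_le_of_nonneg hlam1 hlam⟩
  -- One vector, from `K_{2⌊j/2⌋} ⊆ K_j`, serves both estimates. For odd `j` the lost factor `μ` is
  -- absorbed by dividing the constant by `μ`, as `j ≤ 2⌊j/2⌋ + 1` and `μ < 1`.
  obtain ⟨x, hx, hle⟩ := EKS.exists_approx_pow_abs_E hs hst hδ hσδ b hA hspec (j / 2)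
  rw [← EKS.rate_pow_two_mul] at hle
  refine ⟨x, EKS.extKrylov_mono (by omega) hx, hle, fun h0 => hle.trans ?_⟩
  have hpos := EKS.rate_pos hs hst hσ' h0
  rw [div_mul_eq_mul_div _ (EKS.rate (s ^ 2) (t ^ 2) σ), le_div_iff₀ hpos, mul_assoc, ← pow_succ]
  refine mul_le_mul_of_nonneg_left ?_ (by positivity)
  exact pow_le_pow_of_le_one hpos.le hrate.le (by omega)
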